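/- **Corollary (LSTIC based on the $6\times 6$ perfect STBC).** Let $\omega=e^{2\pi i/3}$, $\zeta_{28}=e^{2\pi i/28}$, $\theta=\zeta_{28}+\zeta_{28}^{-1}=2\cos(\pi/14)$, $\mathbb K=\mathbb Q(\omega)$, $\mathbb L=\mathbb Q(\omega,\theta)$, $\gamma=-\omega$, and let $\sigma$ be the automorphism of $\mathbb L/\mathbb K$ with $\sigma(\theta)=\zeta_{28}^5+\zeta_{28}^{-5}$. For $x=(x_0,\dots,x_5)\in\mathcal O_{\mathbb L}^6$ let $\mathbf X(x)\in\mathbb C^{6\times 6}$ be the matrix with entry $\sigma^i(x_{j-i})$ in position $(i,j)$ if $0\le i\le j\le 5$, and $\gamma\,\sigma^i(x_{j-i+6})$ if $0\le j<i\le 5$. Let $\mathfrak I$ be an ideal of $\mathcal O_{\mathbb L}$ with $7\mathcal O_{\mathbb L}=\mathfrak I^6\,\overline{\mathfrak I}^{\,6}$, where the bar is complex conjugation. Let $K\in\mathbb N$ and let $\mathfrak q_1,\dots,\mathfrak q_K$ be nonzero ideals of $\mathcal O_{\mathbb L}$ that are pairwise relatively prime and relatively prime to $\mathfrak I$; put $\mathfrak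 q=\mathfrak q_1\cdots\mathfrak q_K$, and let $$\mathcal M:\ \mathcal O_{\mathbb L}/\mathfrak q_1\times\cdots\times\mathcal O_{\mathbb L}/\mathfrak q_K\ \to\ \mathfrak I/\mathfrak I\mathfrak q$$ be an isomorphism of $\mathcal O_{\mathbb L}$-modules. A message $w_k=(w_{k,0},\dots,w_{k,5})$ is an element of $(\mathcal O_{\mathbb L}/\mathfrak q_k)^6$. The codewords of the messages $(w_1,\dots,w_K)$ are the matrices $\mathbf X(x)$ with $x_\ell\in\mathfrak I$ in the coset $\mathcal M(w_{1,\ell},\dots,w_{K,\ell})$ for $\ell=0,\dots,5$. The code $\mathcal C$ is the set of the codewords of all messages. For $\mathcal S\subseteq\{1,\dots,K\}$ and known values $w_s=v_s$ $(s\in\mathcal S)$, $\mathcal C_{\mathcal S}$ is the set of the codewords of all messages with $w_s=v_s$ for $s\in\mathcal S$. Let $$\delta(\mathcal D)=\min_{\mathbf X\ne\mathbf X'\in\mathcal D}\det\big((\mathbf X-\mathbf X')(\mathbf X-\mathbf X')^\dagger\big)$$ for $\mathcal D=\mathcal C,\mathcal C_{\mathcal S}$. The rate of $w_k$ is $R_k=\frac{1}{2\cdot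 6^2}\log_2\big|(\mathcal O_{\mathbb L}/\mathfrak q_k)^6\big|$ bits per real symbol, $R_{\mathcal S}=\sum_{s\in\mathcal S}R_s$, and the side information gain is $$\Gamma(\mathcal C,\mathcal S)=\frac{10\log_{10}\big(\delta(\mathcal C_{\mathcal S})/\delta(\mathcal C)\big)}{6\,R_{\mathcal S}} .$$ Let $$\gamma_{\mathfrak I}=20\log_{10}\left(\frac{N(\mathfrak I)}{\min_{0\ne x\in\mathfrak I}N_{\mathbb L/\mathbb Q}(x)}\right).$$ Then $\delta(\mathcal C)>0$, and for every $\mathcal S\subseteq\{1,\dots,K\}$ with $R_{\mathcal S}>0$ (that is, with $\mathfrak q_s\ne\mathcal O_{\mathbb L}$ for some $s\in\mathcal S$) and all values $v_s$, $$\Gamma(\mathcal C,\mathcal S)\ \ge\ 20\log_{10}2+\gamma_{\mathfrak I}\ \ge\ 6+\gamma_{\mathfrak I}\quad\text{dB per bit per real symbol.}$$ The constant $\gamma_{\mathfrak I}$ depends only on $\mathfrak I$, and $\gamma_{\mathfrak I}<0$ if $\mathfrak I$ is not principal. -/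

import Mathlib

namespace SixBySix

open NumberField

noncomputable section

/-- The primitive cube root of unity `ω = exp (2πi/3)`. -/
def omega : ℂ := Complex.exp (2 * Real.pi * Complex.I / 3)

/-- The primitive 28th root of unity `ζ₂₈ = exp (2πi/28)`. -/
def zeta28 : ℂ := Complex.exp (2 * Real.pi * Complex.I / 28)

/-- The real number `θ = 2 cos (π/14)`, seen in `ℂ`. -/
def theta : ℂ := ((2 * Real.cos (Real.pi / 14) : ℝ) : ℂ)

/-- The primitive 84th root of unity; an auxiliary number for constructing `sigma`. -/
def zeta84 : ℂ := Complex.exp (2 * Real.pi * Complex.I / 84)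

theorem zeta84_primitive : IsPrimitiveRoot zeta84 84 := by
  have := Complex.isPrimitiveRoot_exp 84 (by norm_num)
  simpa [zeta84] using this

theorem zeta84_pow_three : zeta84 ^ 3 = zeta28 := by
  rw [zeta84, zeta28, ← Complex.exp_nat_mul]
  congr 1; push_cast; ring

theorem zeta84_pow_28 : zeta84 ^ 28 = omega := by
  rw [zeta84, omega, ← Complex.exp_nat_mul]
  congr 1; push_cast; ring

theorem theta_eq : theta = zeta28 + zeta28⁻¹ := by
  rw [theta, zeta28, ← Complex.exp_neg]
  push_cast
  rw [Complex.two_cos]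
  congr 2 <;> ring

theorem zeta28_ne_zero : zeta28 ≠ 0 := Complex.exp_ne_zero _

/-- The field `L = ℚ(ω, θ)`, a subfield of `ℂ`. -/
abbrev L : IntermediateField ℚ ℂ := IntermediateField.adjoin ℚ {omega, theta}

theorem omega_mem : omega ∈ L := IntermediateField.subset_adjoin ℚ _ (by simp)

theorem theta_mem : theta ∈ L := IntermediateField.subset_adjoin ℚ _ (by simp)

theorem omega_isIntegral : IsIntegral ℚ omega := by
  rw [← zeta84_pow_28]
  exact (zeta84_primitive.isIntegral (by norm_num)).tower_top.pow _

theorem theta_isIntegral : IsIntegral ℚ theta := by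
  have h : IsIntegral ℚ zeta28 := by
    rw [← zeta84_pow_three]
    exact (zeta84_primitive.isIntegral (by norm_num)).tower_top.pow _
  rw [theta_eq]
  exact h.add h.inv

instance : FiniteDimensional ℚ L := by
  apply IntermediateField.finiteDimensional_adjoin
  rintro x (rfl | rfl)
  · exact omega_isIntegral
  · exact theta_isIntegral

instance : NumberField L where

/-- An embedding of `L` in `ℂ` that maps `ω` and `θ` into `L` is an automorphism of `L`. -/
theorem exists_aut (f : L →ₐ[ℚ] ℂ) (h1 : f ⟨omega, omega_mem⟩ ∈ L)
    (h2 : f ⟨theta, theta_mem⟩ ∈ L) : ∃ s : L ≃ₐ[ℚ] L, ∀ x, (s x : ℂ) = f x := by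
  have key : ∀ x : L, f x ∈ L := by
    rintro ⟨x, hx⟩
    induction hx using IntermediateField.adjoin_induction with
    | mem y hy =>
      rcases hy with rfl | rfl
      · exact h1
      · exact h2
    | algebraMap y =>
      have h : f ⟨algebraMap ℚ ℂ y, L.algebraMap_mem y⟩ = algebraMap ℚ ℂ y := f.commutes y
      rw [h]
      exact L.algebraMap_mem y
    | add y z hy hz ihy ihz =>
      have h := map_add f ⟨y, hy⟩ ⟨z, hz⟩
      exact h ▸ add_mem ihy ihz
    | inv y hy ih =>
      have h := map_inv₀ f ⟨y, hy⟩
      exact h ▸ inv_mem ih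
    | mul y z hy hz ihy ihz =>
      have h := map_mul f ⟨y, hy⟩ ⟨z, hz⟩
      exact h ▸ mul_mem ihy ihz
  let g : L →ₐ[ℚ] L := f.codRestrict L.toSubalgebra key
  exact ⟨AlgEquiv.ofBijective g (Algebra.IsAlgebraic.algHom_bijective g), fun x => rfl⟩

theorem exists_sigma : ∃ s : L ≃ₐ[ℚ] L, (s ⟨omega, omega_mem⟩ : ℂ) = omega ∧
    (s ⟨theta, theta_mem⟩ : ℂ) = zeta28 ^ 5 + (zeta28 ^ 5)⁻¹ := by
  let E : IntermediateField ℚ ℂ := IntermediateField.adjoin ℚ {zeta84}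
  have hz : zeta84 ∈ E := IntermediateField.mem_adjoin_simple_self ℚ zeta84
  have hLE : L ≤ E := by
    apply IntermediateField.adjoin_le_iff.2
    rintro x (rfl | rfl)
    · rw [← zeta84_pow_28]
      exact pow_mem hz _
    · rw [theta_eq, ← zeta84_pow_three]
      exact add_mem (pow_mem hz _) (inv_mem (pow_mem hz _))
  have hint : IsIntegral ℚ zeta84 := (zeta84_primitive.isIntegral (by norm_num)).tower_top
  have hprim : IsPrimitiveRoot (zeta84 ^ 61) 84 :=
    zeta84_primitive.pow_of_coprime 61 (by norm_num)
  have hroot : Polynomial.aeval (zeta84 ^ 61) (minpoly ℚ zeta84) = 0 := by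
    rw [← Polynomial.cyclotomic_eq_minpoly_rat zeta84_primitive (by norm_num),
      Polynomial.cyclotomic_eq_minpoly_rat hprim (by norm_num)]
    exact minpoly.aeval _ _
  let t : E →ₐ[ℚ] ℂ := (IntermediateField.algHomAdjoinIntegralEquiv ℚ hint).symm
    ⟨zeta84 ^ 61, (Polynomial.mem_aroots).2 ⟨minpoly.ne_zero hint, hroot⟩⟩
  have ht : t ⟨zeta84, hz⟩ = zeta84 ^ 61 :=
    IntermediateField.algHomAdjoinIntegralEquiv_symm_apply_gen ℚ hint _
  let f : L →ₐ[ℚ] ℂ := t.comp (IntermediateField.inclusion hLE)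
  have hp : zeta84 ^ 84 = 1 := zeta84_primitive.pow_eq_one
  have h28 : zeta28 ^ 28 = 1 := by rw [← zeta84_pow_three, ← pow_mul]; exact hp
  have hw : f ⟨omega, omega_mem⟩ = omega := by
    have e : IntermediateField.inclusion hLE ⟨omega, omega_mem⟩ = (⟨zeta84, hz⟩ : E) ^ 28 :=
      Subtype.ext zeta84_pow_28.symm
    change t (IntermediateField.inclusion hLE ⟨omega, omega_mem⟩) = omega
    rw [e, map_pow, ht, ← zeta84_pow_28]
    calc (zeta84 ^ 61) ^ 28 = (zeta84 ^ 84) ^ 20 * zeta84 ^ 28 := by ring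
      _ = zeta84 ^ 28 := by rw [hp]; ring
  have hth : f ⟨theta, theta_mem⟩ = zeta28 ^ 5 + (zeta28 ^ 5)⁻¹ := by
    have e : IntermediateField.inclusion hLE ⟨theta, theta_mem⟩ =
        (⟨zeta84, hz⟩ : E) ^ 3 + ((⟨zeta84, hz⟩ : E) ^ 3)⁻¹ :=
      Subtype.ext (by
        change theta = zeta84 ^ 3 + (zeta84 ^ 3)⁻¹
        rw [theta_eq, zeta84_pow_three])
    change t (IntermediateField.inclusion hLE ⟨theta, theta_mem⟩) = _
    have e2 : (zeta84 ^ 61) ^ 3 = zeta28 ^ 5 := by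
      calc (zeta84 ^ 61) ^ 3 = (zeta84 ^ 3) ^ 61 := by ring
        _ = zeta28 ^ 61 := by rw [zeta84_pow_three]
        _ = (zeta28 ^ 28) ^ 2 * zeta28 ^ 5 := by ring
        _ = zeta28 ^ 5 := by rw [h28]; ring
    rw [e, map_add, map_inv₀, map_pow, ht, e2]
  have hmem : zeta28 ^ 5 + (zeta28 ^ 5)⁻¹ ∈ L := by
    have h : zeta28 ^ 5 + (zeta28 ^ 5)⁻¹ = theta ^ 5 - 5 * theta ^ 3 + 5 * theta := by
      rw [theta_eq]
      field_simp [zeta28_ne_zero]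
      ring
    rw [h]
    have h5 : (5 : ℂ) ∈ L := by exact_mod_cast natCast_mem L 5
    exact add_mem (sub_mem (pow_mem theta_mem _) (mul_mem h5 (pow_mem theta_mem _)))
      (mul_mem h5 theta_mem)
  obtain ⟨s, hs⟩ := exists_aut f (by rw [hw]; exact omega_mem) (by rw [hth]; exact hmem)
  exact ⟨s, by rw [hs, hw], by rw [hs, hth]⟩

/-- The automorphism `σ` of `L` that fixes `ω` and maps `θ = ζ₂₈ + ζ₂₈⁻¹` to `ζ₂₈⁵ + ζ₂₈⁻⁵`. -/
def sigma : L ≃ₐ[ℚ] L := exists_sigma.choose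

theorem sigma_omega : (sigma ⟨omega, omega_mem⟩ : ℂ) = omega := exists_sigma.choose_spec.1

theorem sigma_theta : (sigma ⟨theta, theta_mem⟩ : ℂ) = zeta28 ^ 5 + (zeta28 ^ 5)⁻¹ :=
  exists_sigma.choose_spec.2

theorem exists_conj : ∃ s : L ≃ₐ[ℚ] L, ∀ x, (s x : ℂ) = starRingEnd ℂ (x : ℂ) := by
  let f : L →ₐ[ℚ] ℂ := (Complex.conjAe.restrictScalars ℚ).toAlgHom.comp L.val
  have hw : f ⟨omega, omega_mem⟩ = omega⁻¹ := by
    change starRingEnd ℂ omega = omega⁻¹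
    rw [omega, ← Complex.exp_conj, ← Complex.exp_neg]
    congr 1
    simp only [map_div₀, map_mul, map_ofNat, Complex.conj_ofReal, Complex.conj_I]
    ring
  have hth : f ⟨theta, theta_mem⟩ = theta := Complex.conj_ofReal _
  obtain ⟨s, hs⟩ := exists_aut f (by rw [hw]; exact inv_mem omega_mem)
    (by rw [hth]; exact theta_mem)
  exact ⟨s, hs⟩

/-- Complex conjugation on `L`. -/
def conjL : L ≃ₐ[ℚ] L := exists_conj.choose

theorem conjL_apply (x : L) : (conjL x : ℂ) = starRingEnd ℂ (x : ℂ) := exists_conj.choose_spec x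

/-- The conjugate ideal: the image of `I` under complex conjugation. -/
def conjIdeal (I : Ideal (𝓞 L)) : Ideal (𝓞 L) :=
  I.map (RingOfIntegers.mapRingEquiv conjL.toRingEquiv)

/-- The codeword matrix of `x₀ + x₁ e + ⋯ + x₅ e⁵` in the cyclic algebra `(L/ℚ(ω), σ, γ)`,
`e⁶ = γ = -ω`: the entry in row `i` and column `j` is `σ^i (x_{j-i})` for `i ≤ j` and
`γ σ^i (x_{j-i+6})` for `j < i`. (The index `j - i` below is taken modulo 6.) -/
def codeword (x : Fin 6 → 𝓞 L) : Matrix (Fin 6) (Fin 6) ℂ :=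
  Matrix.of fun i j =>
    (if j < i then -omega else 1) * (((sigma ^ (i : ℕ)) ((x (j - i) : 𝓞 L) : L) : L) : ℂ)

/-- The minimum determinant `δ(C)`: the minimum of `det ((X - X') (X - X')ᴴ)` over distinct
codewords (such a determinant is a nonnegative real number). -/
def minDet (C : Set (Matrix (Fin 6) (Fin 6) ℂ)) : ℝ :=
  sInf {d | ∃ X ∈ C, ∃ X' ∈ C, X ≠ X' ∧
    d = (Matrix.det ((X - X') * (X - X').conjTranspose)).re}

section Code

variable {K : ℕ} (I : Ideal (𝓞 L)) (q : Fin K → Ideal (𝓞 L))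

/-- The message tuples `(w₁, …, w_K)`: each `w_k = (w_{k,0}, …, w_{k,5})` lies in `(𝓞_L/𝔮_k)⁶`. -/
abbrev Messages : Type := ∀ k : Fin K, Fin 6 → 𝓞 L ⧸ q k

/-- The quotient `I / I𝔮`, where `𝔮 = 𝔮₁ ⋯ 𝔮_K`. -/
abbrev LayerQuotient : Type := I ⧸ (I * ∏ k, q k).submoduleOf I

/-- The layer map: an isomorphism `𝓞_L/𝔮₁ × ⋯ × 𝓞_L/𝔮_K ≅ I / I𝔮`. -/
abbrev LayerMap : Type := (∀ k : Fin K, 𝓞 L ⧸ q k) ≃ₗ[𝓞 L] LayerQuotient I q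

variable {I q}

/-- The codewords that carry the message tuple `w`: the layer `ℓ` is in the coset
`M (w_{1,ℓ}, …, w_{K,ℓ})` of `I𝔮` in `I`. -/
def encode (M : LayerMap I q) (w : Messages q) : Set (Matrix (Fin 6) (Fin 6) ℂ) :=
  {X | ∃ x : Fin 6 → I,
    (∀ l, (Submodule.Quotient.mk (x l) : LayerQuotient I q) = M fun k => w k l) ∧
    X = codeword fun l => (x l : 𝓞 L)}

/-- The layered space-time index code `C`. -/
def code (M : LayerMap I q) : Set (Matrix (Fin 6) (Fin 6) ℂ) := ⋃ w, encode M w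

/-- The subcode `C_S` for the side information `w_s = v_s`, `s ∈ S`. -/
def subcode (M : LayerMap I q) (S : Finset (Fin K)) (v : Messages q) :
    Set (Matrix (Fin 6) (Fin 6) ℂ) :=
  ⋃ w ∈ {w : Messages q | ∀ s ∈ S, w s = v s}, encode M w

variable (q)

/-- The rate of the message `w_k` in bits per real symbol: `log₂` of the number of its values, over
the `2 · 6²` real symbols of a codeword. -/
def rate (k : Fin K) : ℝ := Real.logb 2 (Nat.card (Fin 6 → 𝓞 L ⧸ q k)) / (2 * 6 ^ 2)

variable {q}

/-- The normalized side information gain `Γ(C, S)`, for `n_t = 6` transmit antennas. -/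
def gain (M : LayerMap I q) (S : Finset (Fin K)) (v : Messages q) : ℝ :=
  10 * Real.logb 10 (minDet (subcode M S v) / minDet (code M)) / (6 * ∑ s ∈ S, rate q s)

end Code

/-- The minimum of `N_{L/ℚ}(x)` over the nonzero `x ∈ I`. (`L` is totally complex, so that norms
are nonnegative and the absolute value changes nothing.) -/
def minNorm (I : Ideal (𝓞 L)) : ℕ :=
  sInf {m | ∃ x ∈ I, x ≠ 0 ∧ m = (Algebra.norm ℤ x).natAbs}

/-- The constant `γ_I = 20 log₁₀ (N(I) / min N_{L/ℚ}(x))`. -/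
def gammaI (I : Ideal (𝓞 L)) : ℝ :=
  20 * Real.logb 10 ((Ideal.absNorm I : ℝ) / (minNorm I : ℝ))

end

end SixBySix

namespace SixBySix

open NumberField

noncomputable section

/-! Differences of codewords are again matrices `X(x)`, so everything rests on bounding `|det
X(x)|²` for `x ≠ 0` with entries in an ideal `J`. Row `i` of `X(x)` lies in `σ^i(J)`, hence the
determinant lies in `∏ σ^i(J)`, of norm `N(J)^6`. The determinant is also fixed by `σ`, so its norm
to `ℚ` is `|det|^12`. If it is nonzero, then `|det|² ≥ N(J)` (`absNorm_le_normSq_det`).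

Nonvanishing (`det_codewordO_ne_zero`) comes from reduction modulo `I`. The factorization of 7
forces `N(I) = 7`, and `σ` fixes `I` and acts trivially on `𝓞/I = 𝔽₇`. So `X(x)` reduces to
multiplication by an element of `𝔽₇[t]/(t^6 + ω)`, which is a field because `-ω` has order 6 in
`𝔽₇`. The determinant is then nonzero modulo `I` as soon as some `x_l` is outside `I`, and scaling
by an element of `L` reduces every nonzero `x` to this case.

Differences in `C_S` have entries in `I ∏_{s∈S} q_s`, so `δ(C_S) ≥ N(I) Q` with `Q = N(∏_{s∈S}
q_s)`. The diagonal codewords `X(z,0,…,0)` give `δ(C) ≤ min N(z)`. Since `R_S = log₂ Q / 12`, the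
gain is at least `20 log₁₀ 2 + γ_I / log₂ Q`, and `γ_I ≤ 0`, `log₂ Q ≥ 1` give the bound. -/

/-! ### The Galois group of `L` -/

/-- `ω` as an element of `L`. -/
def omegaL : L := ⟨omega, omega_mem⟩

/-- `θ` as an element of `L`. -/
def thetaL : L := ⟨theta, theta_mem⟩

@[simp] theorem coe_thetaL : (thetaL : ℂ) = theta := rfl

theorem aut_ext {s t : L ≃ₐ[ℚ] L} (h1 : s omegaL = t omegaL) (h2 : s thetaL = t thetaL) :
    s = t := by
  have h : (s : L →ₐ[ℚ] L) = t := by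
    apply IntermediateField.adjoin_algHom_ext
    rintro x (rfl | rfl)
    · exact h1
    · exact h2
  exact AlgEquiv.ext fun x => congrArg (fun f : L →ₐ[ℚ] L => f x) h

theorem omega_primitive : IsPrimitiveRoot omega 3 := by
  have := Complex.isPrimitiveRoot_exp 3 (by norm_num)
  simpa [omega] using this

theorem omega_sq_add : omega ^ 2 + omega + 1 = 0 := by
  have h := omega_primitive.geom_sum_eq_zero (by norm_num)
  simp only [Finset.sum_range_succ, Finset.sum_range_zero] at h
  linear_combination h

theorem omegaL_sq_add : omegaL ^ 2 + omegaL + 1 = 0 := Subtype.ext omega_sq_add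

theorem omegaL_pow_three : omegaL ^ 3 = 1 := by
  linear_combination (omegaL - 1) * omegaL_sq_add

theorem omegaL_ne_zero : omegaL ≠ 0 := fun h => by
  have := omegaL_pow_three
  simp [h] at this

theorem zeta28_pow_14 : zeta28 ^ 14 = -1 := by
  rw [zeta28, ← Complex.exp_nat_mul, ← Complex.exp_pi_mul_I]
  congr 1; push_cast; ring

theorem thetaL_ne_zero : thetaL ≠ 0 := by
  intro h
  have h : ((2 * Real.cos (Real.pi / 14) : ℝ) : ℂ) = 0 := congrArg Subtype.val h
  have h1 : 0 < Real.cos (Real.pi / 14) := Real.cos_pos_of_mem_Ioo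
    ⟨by linarith [Real.pi_pos], by linarith [Real.pi_pos]⟩
  rw [Complex.ofReal_eq_zero] at h
  linarith

theorem theta_poly : theta ^ 6 - 7 * theta ^ 4 + 14 * theta ^ 2 - 7 = 0 := by
  have hz := zeta28_ne_zero
  have h0 : theta ≠ 0 := fun h => thetaL_ne_zero (Subtype.ext h)
  have h1 : zeta28 * theta = zeta28 ^ 2 + 1 := by
    rw [theta_eq]
    field_simp
  have h2 : zeta28 ^ 6 * (theta ^ 6 - 7 * theta ^ 4 + 14 * theta ^ 2 - 7) =
      zeta28 ^ 12 - zeta28 ^ 10 + zeta28 ^ 8 - zeta28 ^ 6 + zeta28 ^ 4 - zeta28 ^ 2 + 1 := by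
    rw [theta_eq]
    field_simp
    ring
  apply mul_left_cancel₀ (pow_ne_zero 6 hz)
  -- `ζθ = ζ² + 1`, and `ζ² + 1` times the alternating sum in `h2` telescopes to `ζ^14 + 1 = 0`.
  apply mul_left_cancel₀ (mul_ne_zero hz h0)
  rw [h2, h1]
  linear_combination zeta28_pow_14

@[simp] theorem sigma_omegaL : sigma omegaL = omegaL := Subtype.ext sigma_omega

theorem sigma_pow_omegaL (k : ℕ) : (sigma ^ k) omegaL = omegaL := by
  induction k with
  | zero => rfl
  | succ k ih => rw [pow_succ, AlgEquiv.mul_apply, sigma_omegaL, ih]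

theorem add_inv_pow_five {z : ℂ} (hz : z ≠ 0) :
    z ^ 5 + (z ^ 5)⁻¹ = (z + z⁻¹) ^ 5 - 5 * (z + z⁻¹) ^ 3 + 5 * (z + z⁻¹) := by
  field_simp
  ring

theorem sigma_thetaL : sigma thetaL = thetaL ^ 5 - 5 * thetaL ^ 3 + 5 * thetaL := by
  apply Subtype.ext
  change (sigma ⟨theta, theta_mem⟩ : ℂ) = theta ^ 5 - 5 * theta ^ 3 + 5 * theta
  rw [sigma_theta, add_inv_pow_five zeta28_ne_zero, theta_eq]

theorem sigma_pow_thetaL (k : ℕ) :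
    ((sigma ^ k) thetaL : ℂ) = zeta28 ^ 5 ^ k + (zeta28 ^ 5 ^ k)⁻¹ := by
  induction k with
  | zero => simp [theta_eq]
  | succ k ih =>
    have h : (sigma ^ (k + 1)) thetaL =
        ((sigma ^ k) thetaL) ^ 5 - 5 * ((sigma ^ k) thetaL) ^ 3 + 5 * (sigma ^ k) thetaL := by
      rw [pow_succ, AlgEquiv.mul_apply, sigma_thetaL]
      simp only [map_add, map_sub, map_mul, map_pow, map_ofNat]
    rw [h]
    change ((sigma ^ k) thetaL : ℂ) ^ 5 - 5 * ((sigma ^ k) thetaL : ℂ) ^ 3 +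
      5 * ((sigma ^ k) thetaL : ℂ) = _
    rw [ih, ← add_inv_pow_five (pow_ne_zero _ zeta28_ne_zero), ← pow_mul, ← pow_succ]

/-- `5³ ≡ 13 (mod 28)` and `ζ^13 = -ζ⁻¹`. -/
theorem sigma_pow_three_thetaL : (sigma ^ 3) thetaL = -thetaL := by
  apply Subtype.ext
  rw [sigma_pow_thetaL]
  have h : zeta28 ^ 5 ^ 3 = -zeta28⁻¹ := by
    rw [eq_neg_iff_add_eq_zero, ← mul_right_inj' zeta28_ne_zero, mul_add,
      mul_inv_cancel₀ zeta28_ne_zero]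
    calc zeta28 * zeta28 ^ 5 ^ 3 + 1 = (zeta28 ^ 14) ^ 9 + 1 := by ring
      _ = zeta28 * 0 := by rw [zeta28_pow_14]; ring
  rw [h]
  change _ = -theta
  rw [theta_eq, inv_neg, inv_inv]
  ring

theorem sigma_sq_thetaL : (sigma ^ 2) thetaL = thetaL ^ 3 - 3 * thetaL := by
  apply Subtype.ext
  rw [sigma_pow_thetaL]
  have h : zeta28 ^ 5 ^ 2 = (zeta28 ^ 3)⁻¹ := by
    rw [← mul_left_inj' (pow_ne_zero 3 zeta28_ne_zero),
      inv_mul_cancel₀ (pow_ne_zero 3 zeta28_ne_zero)]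
    calc zeta28 ^ 5 ^ 2 * zeta28 ^ 3 = (zeta28 ^ 14) ^ 2 := by ring
      _ = 1 := by rw [zeta28_pow_14]; ring
  rw [h]
  change _ = theta ^ 3 - 3 * theta
  rw [theta_eq]
  field_simp [zeta28_ne_zero]
  ring

theorem sigma_pow_six : sigma ^ 6 = 1 := by
  apply aut_ext
  · rw [sigma_pow_omegaL, AlgEquiv.one_apply]
  · rw [show 6 = 3 + 3 from rfl, pow_add, AlgEquiv.mul_apply, sigma_pow_three_thetaL, map_neg,
      sigma_pow_three_thetaL, neg_neg, AlgEquiv.one_apply]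

theorem thetaL_sq_ne_four : thetaL ^ 2 ≠ 4 := by
  intro h
  have h : (((2 * Real.cos (Real.pi / 14)) : ℝ) : ℂ) ^ 2 = 4 := congrArg Subtype.val h
  have h2 : (2 * Real.cos (Real.pi / 14)) ^ 2 = 4 := by exact_mod_cast h
  have h1 : 0 < Real.sin (Real.pi / 14) := Real.sin_pos_of_pos_of_lt_pi
    (by linarith [Real.pi_pos]) (by linarith [Real.pi_pos])
  nlinarith [Real.sin_sq_add_cos_sq (Real.pi / 14)]

/-- `σ³ = 1` would give `θ = -θ`, and `σ² = 1` would give `θ³ - 3θ = θ`, that is `θ² = 4`. -/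
theorem orderOf_sigma : orderOf sigma = 6 := by
  apply orderOf_eq_of_pow_and_pow_div_prime (by norm_num) sigma_pow_six
  intro p hp hd
  have hp' : p = 2 ∨ p = 3 := by
    rw [show 6 = 2 * 3 from rfl, hp.dvd_mul, Nat.prime_dvd_prime_iff_eq hp Nat.prime_two,
      Nat.prime_dvd_prime_iff_eq hp Nat.prime_three] at hd
    exact hd
  rcases hp' with rfl | rfl
  · intro h
    have h1 := sigma_pow_three_thetaL
    rw [show 6 / 2 = 3 from rfl] at h
    rw [h, AlgEquiv.one_apply] at h1
    exact thetaL_ne_zero (self_eq_neg.1 h1)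
  · intro h
    have h1 := sigma_sq_thetaL
    rw [show 6 / 3 = 2 from rfl] at h
    rw [h, AlgEquiv.one_apply] at h1
    apply thetaL_sq_ne_four
    apply mul_left_cancel₀ thetaL_ne_zero
    linear_combination -h1

theorem conjL_omegaL : conjL omegaL = omegaL ^ 2 := by
  apply Subtype.ext
  rw [conjL_apply]
  have h : starRingEnd ℂ omega = omega⁻¹ := by
    rw [omega, ← Complex.exp_conj, ← Complex.exp_neg]
    congr 1
    simp only [map_div₀, map_mul, map_ofNat, Complex.conj_ofReal, Complex.conj_I]
    ring
  change starRingEnd ℂ omega = omega ^ 2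
  have h0 : omega ≠ 0 := Complex.exp_ne_zero _
  rw [h, inv_eq_iff_eq_inv, ← mul_left_inj' (pow_ne_zero 2 h0),
    inv_mul_cancel₀ (pow_ne_zero 2 h0), ← pow_succ', omega_primitive.pow_eq_one]

theorem conjL_thetaL : conjL thetaL = thetaL := by
  apply Subtype.ext
  rw [conjL_apply]
  exact Complex.conj_ofReal _

theorem omegaL_sq_ne : omegaL ^ 2 ≠ omegaL := by
  intro h
  have h1 : omegaL = 1 := mul_left_cancel₀ omegaL_ne_zero (by linear_combination h)
  have h2 := omegaL_sq_add
  rw [h1] at h2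
  norm_num at h2

theorem finrank_adjoin_simple_le {x : ℂ} (hx : IsIntegral ℚ x) {p : Polynomial ℚ}
    (hp : p ≠ 0) (h : Polynomial.aeval x p = 0) :
    Module.finrank ℚ (IntermediateField.adjoin ℚ {x}) ≤ p.natDegree := by
  rw [IntermediateField.adjoin.finrank hx]
  exact Polynomial.natDegree_le_of_dvd (minpoly.dvd ℚ x h) hp

theorem finrank_L_le : Module.finrank ℚ L ≤ 12 := by
  have hL : L = IntermediateField.adjoin ℚ {omega} ⊔ IntermediateField.adjoin ℚ {theta} := by
    rw [← IntermediateField.adjoin_union, Set.singleton_union]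
  have h1 : Module.finrank ℚ (IntermediateField.adjoin ℚ {omega}) ≤ 2 := by
    have hd : (Polynomial.X ^ 2 + Polynomial.X + 1 : Polynomial ℚ).natDegree = 2 := by
      compute_degree!
    rw [← hd]
    apply finrank_adjoin_simple_le omega_isIntegral
    · intro h
      simp [h] at hd
    · simpa using omega_sq_add
  have h2 : Module.finrank ℚ (IntermediateField.adjoin ℚ {theta}) ≤ 6 := by
    have hd : (Polynomial.X ^ 6 - 7 * Polynomial.X ^ 4 + 14 * Polynomial.X ^ 2 - 7 :
        Polynomial ℚ).natDegree = 6 := by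
      compute_degree!
    rw [← hd]
    apply finrank_adjoin_simple_le theta_isIntegral
    · intro h
      simp [h] at hd
    · simpa only [map_add, map_sub, map_mul, map_pow, Polynomial.aeval_X, map_ofNat] using
        theta_poly
  rw [hL]
  exact (IntermediateField.finrank_sup_le _ _).trans (Nat.mul_le_mul h1 h2)

/-- The twelve automorphisms `σ^i` and `σ^i` composed with complex conjugation. -/
def autMap (p : Fin 6 × Fin 2) : L ≃ₐ[ℚ] L := sigma ^ (p.1 : ℕ) * conjL ^ (p.2 : ℕ)

theorem autMap_injective : Function.Injective autMap := by
  rintro ⟨i, j⟩ ⟨i', j'⟩ h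
  -- The image of `ω` detects the exponent of conjugation, since `σ` fixes `ω` and conjugation
  -- squares it.
  have hj : j = j' := by
    have h1 := congrArg (fun s : L ≃ₐ[ℚ] L => s omegaL) h
    fin_cases j <;> fin_cases j' <;>
      simp [-AlgEquiv.coe_pow, autMap, sigma_pow_omegaL, conjL_omegaL, omegaL_sq_ne,
        omegaL_sq_ne.symm] at h1 ⊢
  subst hj
  have h2 : sigma ^ (i : ℕ) = sigma ^ (i' : ℕ) := mul_right_cancel h
  have h3 : (i : ℕ) = i' := pow_injOn_Iio_orderOf (by simp [orderOf_sigma])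
    (by simp [orderOf_sigma]) h2
  rw [Fin.ext h3]

/-- The annihilating polynomials bound the degree by `2 · 6`, and twelve distinct automorphisms
bound it from below; no irreducibility is needed. -/
theorem finrank_L : Module.finrank ℚ L = 12 := by
  apply le_antisymm finrank_L_le
  have h := Fintype.card_le_of_injective _ autMap_injective
  simp only [Fintype.card_prod, Fintype.card_fin] at h
  exact h.trans AlgEquiv.card_le

theorem autMap_bijective : Function.Bijective autMap := by
  rw [Fintype.bijective_iff_injective_and_card]
  refine ⟨autMap_injective, le_antisymm (Fintype.card_le_of_injective _ autMap_injective) ?_⟩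
  have h := AlgEquiv.card_le (F := ℚ) (K := L)
  rw [finrank_L] at h
  simpa using h

instance isGalois_L : IsGalois ℚ L := by
  apply IsGalois.of_card_aut_eq_finrank
  rw [finrank_L, Nat.card_congr (Equiv.ofBijective _ autMap_bijective).symm]
  simp

/-- The relative norm of `L` over `ℚ(ω)`, as an element of `L`. -/
def relNorm (x : L) : L := ∏ i : Fin 6, (sigma ^ (i : ℕ)) x

theorem sigma_conjL_comm : sigma * conjL = conjL * sigma := by
  apply aut_ext
  · simp [conjL_omegaL]
  · simp only [AlgEquiv.mul_apply, conjL_thetaL, sigma_thetaL, map_sub, map_add, map_mul,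
      map_pow, map_ofNat]

theorem relNorm_conjL (x : L) : relNorm (conjL x) = conjL (relNorm x) := by
  rw [relNorm, relNorm, map_prod]
  refine Finset.prod_congr rfl fun i _ => ?_
  have h : Commute sigma conjL := sigma_conjL_comm
  rw [← AlgEquiv.mul_apply, ← AlgEquiv.mul_apply, (h.pow_left i).eq]

/-- The Galois group splits into the powers of `σ` and their products with conjugation, which
contribute conjugate factors. -/
theorem norm_eq_normSq_relNorm (x : L) :
    ((Algebra.norm ℚ x : ℚ) : ℝ) = Complex.normSq (relNorm x : ℂ) := by
  have h1 : algebraMap ℚ L (Algebra.norm ℚ x) = relNorm x * conjL (relNorm x) := by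
    rw [Algebra.norm_eq_prod_automorphisms,
      ← (Equiv.ofBijective _ autMap_bijective).prod_comp, Fintype.prod_prod_type_right,
      Fin.prod_univ_two, ← relNorm_conjL]
    simp [autMap, relNorm]
  have h2 := congrArg (Subtype.val : L → ℂ) h1
  apply Complex.ofReal_injective
  rw [← Complex.mul_conj, ← conjL_apply]
  rw [IntermediateField.coe_mul] at h2
  rw [← h2]
  simp

/-! ### Cyclic matrices over a field with seven elements -/

section Residue

open Polynomial

variable {F : Type*} [Field F]

theorem root_pow_six {f : F[X]} {g : F} (hf : f ∣ X ^ 6 - C g) :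
    AdjoinRoot.root f ^ 6 = AdjoinRoot.of f g := by
  have h := AdjoinRoot.mk_eq_zero.2 hf
  rw [map_sub, map_pow, AdjoinRoot.mk_X, AdjoinRoot.mk_C, sub_eq_zero] at h
  exact h

/-- A root `a` of an irreducible factor of degree `d` generates a field with `7^d` elements, so
`a^(7^d - 1) = 1`. As `a^6 = g` has order 6, this excludes `d < 6`. -/
theorem irreducible_X_pow_six_sub_C (hF : Nat.card F = 7) {g : F} (hg : g ^ 2 - g + 1 = 0) :
    Irreducible (X ^ 6 - C g : F[X]) := by
  have : Finite F := Nat.finite_of_card_ne_zero (by rw [hF]; norm_num)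
  have h7 : (7 : F) = 0 := by
    have : Fintype F := Fintype.ofFinite F
    have h := FiniteField.cast_card_eq_zero F
    rw [← Nat.card_eq_fintype_card, hF] at h
    exact_mod_cast h
  have h3 : g ^ 3 = -1 := by linear_combination (g + 1) * hg
  have h6 : g ^ 6 = 1 := by linear_combination (g ^ 3 - 1) * h3
  have hdeg : (X ^ 6 - C g : F[X]).natDegree = 6 := natDegree_X_pow_sub_C
  have hne : (X ^ 6 - C g : F[X]) ≠ 0 := fun h => by simp [h] at hdeg
  obtain ⟨f, hf, hfd⟩ := exists_irreducible_of_natDegree_ne_zero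
    (f := (X ^ 6 - C g : F[X])) (by rw [hdeg]; norm_num)
  have hle : 6 ≤ f.natDegree := by
    by_contra! hlt
    have : Fact (Irreducible f) := ⟨hf⟩
    have : Module.Finite F (AdjoinRoot f) := (AdjoinRoot.powerBasis hf.ne_zero).finite
    have : Finite (AdjoinRoot f) := Module.finite_of_finite F
    have : Fintype (AdjoinRoot f) := Fintype.ofFinite _
    have hcard : Fintype.card (AdjoinRoot f) = 7 ^ f.natDegree := by
      rw [← Nat.card_eq_fintype_card, Module.natCard_eq_pow_finrank (K := F), hF,
        (AdjoinRoot.powerBasis hf.ne_zero).finrank, AdjoinRoot.powerBasis_dim]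
    set a : AdjoinRoot f := AdjoinRoot.root f with ha
    have hroot : a ^ 6 = AdjoinRoot.of f g := root_pow_six hfd
    have hg0 : g ≠ 0 := by rintro rfl; simp at hg
    have ha0 : a ≠ 0 := by
      intro h
      rw [h, zero_pow (by norm_num)] at hroot
      exact hg0 ((map_eq_zero _).1 hroot.symm)
    have hpow := FiniteField.pow_card_sub_one_eq_one a ha0
    rw [hcard] at hpow
    have key : ∀ m, a ^ (6 * m) = 1 → g ^ m = 1 := by
      intro m hm
      rw [pow_mul, hroot, ← map_pow] at hm
      exact (AdjoinRoot.of f).injective (by rw [hm, map_one])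
    have hd := hf.natDegree_pos
    have hred : ∀ m, g ^ m = g ^ (m % 6) := fun m => by
      conv_lhs => rw [← Nat.div_add_mod m 6, pow_add, pow_mul, h6, one_pow, one_mul]
    -- Here `m = (7^d - 1)/6 = 1 + 7 + ⋯ + 7^(d-1) ≡ d (mod 6)`, so `g^d = 1` with `0 < d < 6`,
    -- against `g² - g + 1 = 0` in characteristic 7.
    interval_cases hn : f.natDegree
    · have h := key 1 hpow
      exact one_ne_zero (by linear_combination hg - g * h : (1 : F) = 0)
    · have h := key 8 hpow
      rw [hred, show 8 % 6 = 2 from rfl] at h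
      exact one_ne_zero (by linear_combination h7 - 2 * (h - (g + 2) * (h - hg)) : (1 : F) = 0)
    · have h := key 57 hpow
      rw [hred, show 57 % 6 = 3 from rfl] at h
      exact one_ne_zero (by linear_combination h7 - 3 * (h3 - h) : (1 : F) = 0)
    · have h := key 400 hpow
      rw [hred, show 400 % 6 = 4 from rfl] at h
      exact one_ne_zero (by linear_combination h7 - 2 * (hg - (g - 2) * (g * h3 - h)) : (1 : F) = 0)
    · have h := key 2801 hpow
      rw [hred, show 2801 % 6 = 5 from rfl] at h
      exact one_ne_zero (by linear_combination hg + g * (g * h - h6) : (1 : F) = 0)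
  obtain ⟨h, hh⟩ := hfd
  have hh0 : h ≠ 0 := by rintro rfl; exact hne (by rw [hh, mul_zero])
  have hhd : h.natDegree = 0 := by
    have := congrArg natDegree hh
    rw [hdeg, natDegree_mul hf.ne_zero hh0] at this
    omega
  have hu : IsUnit h := by
    rw [eq_C_of_natDegree_eq_zero hhd] at hh0 ⊢
    exact isUnit_C.2 (IsUnit.mk0 _ fun h => hh0 (by rw [h, C_0]))
  rw [hh]
  exact (irreducible_mul_isUnit hu).2 hf

/-- The matrix of multiplication by `∑ c_l t^l` modulo `t^6 - g`. -/
def cyclicMatrix {R : Type*} [CommRing R] (g : R) (c : Fin 6 → R) : Matrix (Fin 6) (Fin 6) R :=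
  Matrix.of fun i j => (if j < i then g else 1) * c (j - i)

theorem eq_zero_of_sum_pow_root {g : F} (hg : Irreducible (X ^ 6 - C g : F[X])) (c : Fin 6 → F)
    (h : ∑ i, AdjoinRoot.of (X ^ 6 - C g) (c i) * AdjoinRoot.root (X ^ 6 - C g) ^ (i : ℕ) = 0) :
    c = 0 := by
  have hdeg : (X ^ 6 - C g : F[X]).natDegree = 6 := natDegree_X_pow_sub_C
  have hli := (AdjoinRoot.powerBasis hg.ne_zero).basis.linearIndependent
  have hli := hli.comp (Fin.cast (hdeg.symm.trans (AdjoinRoot.powerBasis_dim _).symm))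
    (Fin.cast_injective _)
  rw [Fintype.linearIndependent_iff] at hli
  funext i
  refine hli c ?_ i
  rw [← h]
  refine Finset.sum_congr rfl fun i _ => ?_
  rw [Algebra.smul_def]
  simp

/-- A vector in the left kernel would be a nonzero element of the field `F[t]/(t^6 - g)` whose
product with `∑ c_l t^l` is zero. -/
theorem det_cyclicMatrix_ne_zero {g : F} (hg : Irreducible (X ^ 6 - C g : F[X])) {c : Fin 6 → F}
    (hc : c ≠ 0) : (cyclicMatrix g c).det ≠ 0 := by
  intro hdet
  obtain ⟨v, hv, hvX⟩ := Matrix.exists_vecMul_eq_zero_iff.2 hdet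
  have : Fact (Irreducible (X ^ 6 - C g : F[X])) := ⟨hg⟩
  set f : F[X] := X ^ 6 - C g with hf
  set a := AdjoinRoot.root f with ha
  have hroot : a ^ 6 = AdjoinRoot.of f g := root_pow_six dvd_rfl
  have hprod : (∑ i, AdjoinRoot.of f (v i) * a ^ (i : ℕ)) *
      (∑ i, AdjoinRoot.of f (c i) * a ^ (i : ℕ)) =
      ∑ j, AdjoinRoot.of f (Matrix.vecMul v (cyclicMatrix g c) j) * a ^ (j : ℕ) := by
    have h1 : (-1 : Fin 6) = 5 := rfl
    have h2 : (-2 : Fin 6) = 4 := rfl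
    have h3 : (-3 : Fin 6) = 3 := rfl
    have h4 : (-4 : Fin 6) = 2 := rfl
    have h5 : (-5 : Fin 6) = 1 := rfl
    simp only [Matrix.vecMul, dotProduct, cyclicMatrix, Matrix.of_apply, Fin.sum_univ_six]
    simp [← hroot, h1, h2, h3, h4, h5]
    ring
  rw [hvX] at hprod
  simp only [Pi.zero_apply, map_zero, zero_mul, Finset.sum_const_zero, mul_eq_zero] at hprod
  rcases hprod with h | h
  · exact hv (eq_zero_of_sum_pow_root hg v h)
  · exact hc (eq_zero_of_sum_pow_root hg c h)

end Residue

/-! ### Codewords over the ring of integers -/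

/-- The automorphism `σ^k` of the ring of integers. -/
def sigmaO (k : ℕ) : 𝓞 L ≃+* 𝓞 L := RingOfIntegers.mapRingEquiv (sigma ^ k).toRingEquiv

@[simp] theorem coe_sigmaO (k : ℕ) (x : 𝓞 L) : (sigmaO k x : L) = (sigma ^ k) (x : L) := rfl

theorem sigmaO_add (j k : ℕ) (x : 𝓞 L) : sigmaO (j + k) x = sigmaO j (sigmaO k x) := by
  apply RingOfIntegers.ext
  simp only [coe_sigmaO, pow_add, AlgEquiv.mul_apply]

theorem sigmaO_zero (x : 𝓞 L) : sigmaO 0 x = x := rfl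

theorem sigmaO_six (x : 𝓞 L) : sigmaO 6 x = x := by
  apply RingOfIntegers.ext
  rw [coe_sigmaO, sigma_pow_six, AlgEquiv.one_apply]

theorem sigmaO_fin_add_one (i : Fin 6) (x : 𝓞 L) :
    sigmaO ((i + 1 : Fin 6) : ℕ) x = sigmaO 1 (sigmaO i x) := by
  rw [← sigmaO_add]
  fin_cases i <;> first | exact (sigmaO_six x).symm | rfl

/-- `ω` as an algebraic integer of `L`. -/
def omegaO : 𝓞 L := ⟨omegaL, (IsIntegral.of_pow (n := 3) (by norm_num)
  (by rw [omegaL_pow_three]; exact isIntegral_one))⟩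

@[simp] theorem coe_omegaO : (omegaO : L) = omegaL := rfl

theorem omegaO_sq_add : omegaO ^ 2 + omegaO + 1 = 0 :=
  RingOfIntegers.ext (by simpa using omegaL_sq_add)

theorem omegaO_ne_zero : omegaO ≠ 0 := fun h => omegaL_ne_zero (by rw [← coe_omegaO, h]; rfl)

@[simp] theorem sigmaO_omegaO (k : ℕ) : sigmaO k omegaO = omegaO :=
  RingOfIntegers.ext (sigma_pow_omegaL k)

/-- The codeword matrix, with entries in the ring of integers. -/
def codewordO (x : Fin 6 → 𝓞 L) : Matrix (Fin 6) (Fin 6) (𝓞 L) :=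
  Matrix.of fun i j => (if j < i then -omegaO else 1) * sigmaO i (x (j - i))

/-- The inclusion of the ring of integers of `L` in `ℂ`. -/
def toComplex : 𝓞 L →+* ℂ := (algebraMap L ℂ).comp (algebraMap (𝓞 L) L)

theorem toComplex_apply (x : 𝓞 L) : toComplex x = ((x : L) : ℂ) := rfl

theorem codeword_eq_map (x : Fin 6 → 𝓞 L) : codeword x = (codewordO x).map toComplex := by
  ext i j
  simp only [codeword, codewordO, Matrix.of_apply, Matrix.map_apply, map_mul]
  congr 1
  split_ifs
  · rw [map_neg]; rfl
  · rw [map_one]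

theorem det_codeword (x : Fin 6 → 𝓞 L) : (codeword x).det = toComplex (codewordO x).det := by
  rw [codeword_eq_map, RingHom.map_det]
  rfl

theorem codeword_sub (x y : Fin 6 → 𝓞 L) : codeword x - codeword y = codeword (x - y) := by
  ext i j
  simp [-AlgEquiv.coe_pow, codeword, mul_sub]

/-- Conjugation by the generator `e` of the cyclic algebra acts on codewords as `σ` on entries: up
to the diagonal matrix `d`, it is a cyclic shift of rows and columns. -/
theorem sigmaO_det_codewordO (x : Fin 6 → 𝓞 L) :
    sigmaO 1 (codewordO x).det = (codewordO x).det := by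
  -- The entry `γ` sits at index 5, where the shift wraps around to 0.
  set d : Fin 6 → 𝓞 L := fun i => if i = 5 then -omegaO else 1 with hd
  have hd0 : (Matrix.diagonal d).det ≠ 0 := by
    rw [Matrix.det_diagonal, Finset.prod_ne_zero_iff]
    intro i _
    rw [hd]
    dsimp only
    split_ifs
    · exact neg_ne_zero.2 omegaO_ne_zero
    · exact one_ne_zero
  have hmat : (codewordO x).map (sigmaO 1) * Matrix.diagonal d =
      Matrix.diagonal d * (codewordO x).submatrix (Equiv.addRight 1) (Equiv.addRight 1) := by
    ext1 i j
    rw [Matrix.mul_diagonal, Matrix.diagonal_mul]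
    simp only [codewordO, Matrix.map_apply, Matrix.of_apply, Matrix.submatrix_apply,
      Equiv.coe_addRight, add_sub_add_right_eq_sub, map_mul, sigmaO_fin_add_one]
    have hc : sigmaO 1 (if j < i then -omegaO else 1) * d j =
        d i * (if j + 1 < i + 1 then -omegaO else 1) := by
      rw [hd]
      fin_cases i <;> fin_cases j <;> simp [Fin.lt_def]
    linear_combination (sigmaO 1 (sigmaO i (x (j - i)))) * hc
  have hdet := congrArg Matrix.det hmat
  rw [Matrix.det_mul, Matrix.det_mul, Matrix.det_submatrix_equiv_self, mul_comm] at hdet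
  have h := mul_left_cancel₀ hd0 hdet
  rw [RingEquiv.map_det]
  exact h

/-- A determinant is in the product of ideals that contain its rows. -/
theorem _root_.Matrix.det_mem_prod {R n : Type*} [CommRing R] [Fintype n] [DecidableEq n]
    (A : Matrix n n R) (J : n → Ideal R) (h : ∀ i j, A i j ∈ J i) : A.det ∈ ∏ i, J i := by
  -- After transposing, the Leibniz products run over rows, as the ideals `J i` do.
  rw [← Matrix.det_transpose, Matrix.det_apply]
  refine Ideal.sum_mem _ fun p _ => ?_
  rw [Units.smul_def]
  refine zsmul_mem (Ideal.prod_mem_prod fun i _ => ?_) _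
  exact h i _

theorem det_codewordO_mem {J : Ideal (𝓞 L)} {x : Fin 6 → 𝓞 L} (hx : ∀ l, x l ∈ J) :
    (codewordO x).det ∈ ∏ i : Fin 6, J.map (sigmaO i) :=
  Matrix.det_mem_prod _ _ fun i j => Ideal.mul_mem_left _ _ (Ideal.mem_map_of_mem _ (hx (j - i)))

theorem absNorm_map_equiv (J : Ideal (𝓞 L)) (e : 𝓞 L ≃+* 𝓞 L) :
    Ideal.absNorm (J.map e) = Ideal.absNorm J := by
  rw [Ideal.absNorm_apply, Ideal.absNorm_apply, Submodule.cardQuot_apply, Submodule.cardQuot_apply]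
  exact (Nat.card_congr (Ideal.quotientEquiv J (J.map e) e rfl).toEquiv).symm

theorem natAbs_norm_eq_normSq (x : 𝓞 L) :
    ((Algebra.norm ℤ x).natAbs : ℝ) = Complex.normSq (relNorm (x : L) : ℂ) := by
  rw [← norm_eq_normSq_relNorm, ← Algebra.coe_norm_int, Nat.cast_natAbs]
  have h : (0 : ℝ) ≤ ((Algebra.norm ℤ x : ℤ) : ℝ) := by
    have := norm_eq_normSq_relNorm (x : L)
    rw [← Algebra.coe_norm_int] at this
    push_cast at this
    rw [this]
    exact Complex.normSq_nonneg _
  push_cast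
  exact abs_of_nonneg h

/-- The determinant is fixed by `σ`, so its relative norm is its sixth power. -/
theorem natAbs_norm_det (x : Fin 6 → 𝓞 L) :
    ((Algebra.norm ℤ (codewordO x).det).natAbs : ℝ) = Complex.normSq (codeword x).det ^ 6 := by
  have h1 : ∀ k, sigmaO k (codewordO x).det = (codewordO x).det := by
    intro k
    induction k with
    | zero => rfl
    | succ k ih => rw [sigmaO_add, sigmaO_det_codewordO, ih]
  have h2 : relNorm ((codewordO x).det : L) = ((codewordO x).det : L) ^ 6 := by
    have h3 : ∀ i ∈ (Finset.univ : Finset (Fin 6)),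
        (sigma ^ (i : ℕ)) ((codewordO x).det : L) = (codewordO x).det := fun i _ => by
      rw [← coe_sigmaO, h1]
    rw [relNorm, Finset.prod_congr rfl h3, Finset.prod_const, Finset.card_univ, Fintype.card_fin]
  rw [natAbs_norm_eq_normSq, h2, det_codeword, toComplex_apply, IntermediateField.coe_pow, map_pow]

theorem absNorm_le_normSq_det {J : Ideal (𝓞 L)} {x : Fin 6 → 𝓞 L} (hx : ∀ l, x l ∈ J)
    (hdet : (codewordO x).det ≠ 0) :
    (Ideal.absNorm J : ℝ) ≤ Complex.normSq (codeword x).det := by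
  have hdvd := Ideal.absNorm_dvd_absNorm_of_le
    ((Ideal.span_singleton_le_iff_mem _).2 (det_codewordO_mem hx))
  rw [map_prod, Ideal.absNorm_span_singleton] at hdvd
  simp only [absNorm_map_equiv, Finset.prod_const, Finset.card_univ, Fintype.card_fin] at hdvd
  have hle := Nat.le_of_dvd (Int.natAbs_pos.2 (Algebra.norm_ne_zero_iff.2 hdet)) hdvd
  have hle' : (Ideal.absNorm J : ℝ) ^ 6 ≤ Complex.normSq (codeword x).det ^ 6 := by
    rw [← natAbs_norm_det]
    exact_mod_cast hle
  exact le_of_pow_le_pow_left₀ (by norm_num) (Complex.normSq_nonneg _) hle'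

theorem codewordO_single (a : 𝓞 L) :
    codewordO (Pi.single 0 a) = Matrix.diagonal fun i : Fin 6 => sigmaO i a := by
  ext1 i j
  rw [codewordO, Matrix.of_apply]
  rcases eq_or_ne i j with rfl | h
  · simp
  · rw [Matrix.diagonal_apply_ne _ h, Pi.single_eq_of_ne (sub_ne_zero.2 h.symm), map_zero, mul_zero]

theorem normSq_det_single (a : 𝓞 L) :
    Complex.normSq (codeword (Pi.single 0 a)).det = (Algebra.norm ℤ a).natAbs := by
  have h : relNorm (a : L) = ((∏ i : Fin 6, sigmaO i a : 𝓞 L) : L) := by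
    exact (map_prod (algebraMap (𝓞 L) L) (fun i : Fin 6 => sigmaO i a) Finset.univ).symm
  rw [natAbs_norm_eq_normSq, det_codeword, codewordO_single, Matrix.det_diagonal, toComplex_apply, h]

/-! ### The division algebra property -/

section Division

variable {I : Ideal (𝓞 L)}

/-- Taking norms, `7^12 = N(I)^6 N(Ī)^6 = N(I)^12`. -/
theorem absNorm_eq_seven (h7 : Ideal.span {(7 : 𝓞 L)} = I ^ 6 * conjIdeal I ^ 6) :
    Ideal.absNorm I = 7 := by
  have h := congrArg Ideal.absNorm h7
  rw [map_mul, map_pow, map_pow, conjIdeal, absNorm_map_equiv,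
    show (7 : 𝓞 L) = ((7 : ℕ) : 𝓞 L) by norm_num, Ideal.absNorm_span_natCast, RingOfIntegers.rank,
    finrank_L, ← pow_add] at h
  exact (Nat.pow_left_injective (by norm_num : 12 ≠ 0) h).symm

theorem isMaximal_of_absNorm (hI : Ideal.absNorm I = 7) : I.IsMaximal := by
  have hp : I.IsPrime := Ideal.isPrime_of_irreducible_absNorm
    (by rw [hI]; exact (by norm_num : Nat.Prime 7))
  refine hp.isMaximal ?_
  rintro rfl
  simp at hI

theorem card_quotient_of_absNorm (hI : Ideal.absNorm I = 7) : Nat.card (𝓞 L ⧸ I) = 7 := by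
  rw [← hI, Ideal.absNorm_apply, Submodule.cardQuot_apply]

theorem exists_int_sub_mem (hI : Ideal.absNorm I = 7) (x : 𝓞 L) : ∃ n : ℤ, x - n ∈ I := by
  have : Fact (Nat.Prime 7) := ⟨by norm_num⟩
  have hmax := isMaximal_of_absNorm hI
  have h1 : (1 : 𝓞 L ⧸ I) ≠ 0 := one_ne_zero
  obtain ⟨n, hn⟩ := AddSubgroup.mem_zmultiples_iff.1
    (mem_zmultiples_of_prime_card (card_quotient_of_absNorm hI) h1
      (g' := Ideal.Quotient.mk I x))
  refine ⟨n, ?_⟩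
  rw [← Ideal.Quotient.mk_eq_mk_iff_sub_mem, ← hn]
  simp

theorem omegaO_sq_sub_notMem {J : Ideal (𝓞 L)} (hJ : J ≠ ⊤) (h7 : (7 : 𝓞 L) ∈ J) :
    omegaO ^ 2 - omegaO ∉ J := by
  intro h
  apply hJ
  rw [Ideal.eq_top_iff_one]
  have h3 : (3 : 𝓞 L) ∈ J := by
    -- `(ω² - ω)² = -3`, and 3 is coprime to 7.
    have e : (3 : 𝓞 L) = (omegaO - omegaO ^ 2) * (omegaO ^ 2 - omegaO) := by
      linear_combination (omegaO ^ 2 - 3 * omegaO + 3) * omegaO_sq_add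
    rw [e]
    exact J.mul_mem_left _ h
  have e : (1 : 𝓞 L) = 7 - 2 * 3 := by norm_num
  rw [e]
  exact J.sub_mem h7 (J.mul_mem_left _ h3)

/-- `σ(I)` is a prime above 7, hence `I` or its conjugate. With `ω ≡ n` modulo `I`, also `ω ≡ n`
modulo `σ(I)` and `ω² ≡ n` modulo the conjugate; if these two ideals agreed, they would contain `ω²
- ω`. -/
theorem map_sigmaO_one_eq (h7 : Ideal.span {(7 : 𝓞 L)} = I ^ 6 * conjIdeal I ^ 6) :
    I.map (sigmaO 1) = I := by
  have hI := absNorm_eq_seven h7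
  have hmaxI := isMaximal_of_absNorm hI
  have hJ : Ideal.absNorm (I.map (sigmaO 1)) = 7 := by rw [absNorm_map_equiv, hI]
  have hmaxJ := isMaximal_of_absNorm hJ
  have hC : Ideal.absNorm (conjIdeal I) = 7 := by rw [conjIdeal, absNorm_map_equiv, hI]
  have hmaxC := isMaximal_of_absNorm hC
  have h7I : (7 : 𝓞 L) ∈ I := by
    have h : Ideal.span {(7 : 𝓞 L)} ≤ I :=
      h7.le.trans (Ideal.mul_le_left.trans (Ideal.pow_le_self (by norm_num)))
    exact (Ideal.span_singleton_le_iff_mem _).1 h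
  have h7J : (7 : 𝓞 L) ∈ I.map (sigmaO 1) := by
    have := Ideal.mem_map_of_mem (sigmaO 1) h7I
    rwa [map_ofNat] at this
  have hle : I ^ 6 * conjIdeal I ^ 6 ≤ I.map (sigmaO 1) := by
    rw [← h7, Ideal.span_singleton_le_iff_mem]
    exact h7J
  rcases (hmaxJ.isPrime.mul_le).1 hle with h | h
  · exact (hmaxI.eq_of_le hmaxJ.ne_top (hmaxJ.isPrime.le_of_pow_le h)).symm
  · exfalso
    have heq := hmaxC.eq_of_le hmaxJ.ne_top (hmaxJ.isPrime.le_of_pow_le h)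
    obtain ⟨n, hn⟩ := exists_int_sub_mem hI omegaO
    have h1 : omegaO - n ∈ I.map (sigmaO 1) := by
      have := Ideal.mem_map_of_mem (sigmaO 1) hn
      rwa [map_sub, sigmaO_omegaO, map_intCast] at this
    have h2 : omegaO ^ 2 - n ∈ I.map (sigmaO 1) := by
      have := Ideal.mem_map_of_mem (RingOfIntegers.mapRingEquiv conjL.toRingEquiv) hn
      have e : RingOfIntegers.mapRingEquiv conjL.toRingEquiv omegaO = omegaO ^ 2 :=
        RingOfIntegers.ext conjL_omegaL
      rw [map_sub, map_intCast, e] at this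
      rw [← heq]
      exact this
    apply omegaO_sq_sub_notMem hmaxJ.ne_top h7J
    have := (I.map (sigmaO 1)).sub_mem h2 h1
    rwa [sub_sub_sub_cancel_right] at this

/-- Every element is congruent to a rational integer modulo `I`, and `σ` fixes both the integer and
`I`. -/
theorem sigmaO_sub_mem (h7 : Ideal.span {(7 : 𝓞 L)} = I ^ 6 * conjIdeal I ^ 6) (k : ℕ)
    (x : 𝓞 L) : sigmaO k x - x ∈ I := by
  have h1 : ∀ x : 𝓞 L, sigmaO 1 x - x ∈ I := by
    intro x
    obtain ⟨n, hn⟩ := exists_int_sub_mem (absNorm_eq_seven h7) x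
    have h := Ideal.mem_map_of_mem (sigmaO 1) hn
    rw [map_sigmaO_one_eq h7, map_sub, map_intCast] at h
    have := I.sub_mem h hn
    rwa [sub_sub_sub_cancel_right] at this
  induction k with
  | zero => simp [sigmaO_zero]
  | succ k ih =>
    rw [add_comm, sigmaO_add, ← sub_add_sub_cancel _ (sigmaO k x) x]
    exact I.add_mem (h1 _) ih

theorem det_codewordO_notMem (h7 : Ideal.span {(7 : 𝓞 L)} = I ^ 6 * conjIdeal I ^ 6)
    {x : Fin 6 → 𝓞 L} (hx : ∃ l, x l ∉ I) : (codewordO x).det ∉ I := by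
  have hI := absNorm_eq_seven h7
  have hmax := isMaximal_of_absNorm hI
  let _ := Ideal.Quotient.field I
  set π := Ideal.Quotient.mk I with hπ
  have hmat : (codewordO x).map π = cyclicMatrix (-π omegaO) (fun l => π (x l)) := by
    ext1 i j
    simp only [codewordO, cyclicMatrix, Matrix.map_apply, Matrix.of_apply, map_mul]
    congr 1
    · split_ifs
      · rw [map_neg]
      · rw [map_one]
    · exact Ideal.Quotient.mk_eq_mk_iff_sub_mem _ _ |>.2 (sigmaO_sub_mem h7 _ _)
  have hg : (-π omegaO) ^ 2 - (-π omegaO) + 1 = 0 := by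
    have h := congrArg π omegaO_sq_add
    rw [map_add, map_add, map_pow, map_one, map_zero] at h
    linear_combination h
  have hirr := irreducible_X_pow_six_sub_C (card_quotient_of_absNorm hI) hg
  have hdet := det_cyclicMatrix_ne_zero hirr (c := fun l => π (x l)) (by
    obtain ⟨l, hl⟩ := hx
    intro h
    exact hl (Ideal.Quotient.eq_zero_iff_mem.1 (congrFun h l)))
  rw [← hmat] at hdet
  intro h
  apply hdet
  rw [← Ideal.Quotient.eq_zero_iff_mem, RingHom.map_det] at h
  exact h

theorem det_codewordO_ne_zero (h7 : Ideal.span {(7 : 𝓞 L)} = I ^ 6 * conjIdeal I ^ 6)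
    {x : Fin 6 → 𝓞 L} (hx : x ≠ 0) : (codewordO x).det ≠ 0 := by
  intro hdet
  obtain ⟨j, hj⟩ := Function.ne_iff.1 hx
  have hmax := isMaximal_of_absNorm (absNorm_eq_seven h7)
  -- `I` need not be principal, so the scalar `a` is taken in `L`: all `a x_l` are integral, but not
  -- all lie in `I`.
  obtain ⟨a, ha, i, -, hi⟩ := Ideal.exist_integer_multiples_notMem (K := L) hmax.ne_top
    Finset.univ (fun l => (x l : L)) (Finset.mem_univ j)
    (fun h => hj (RingOfIntegers.ext h))
  choose y hy using fun l => ha l (Finset.mem_univ l)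
  have hy : ∀ l, (y l : L) = a * (x l : L) := hy
  refine det_codewordO_notMem h7 (x := y) ⟨i, fun h => hi ?_⟩ ?_
  · rw [FractionalIdeal.mem_coeIdeal]
    exact ⟨y i, h, hy i⟩
  · have hmat : (codewordO y).map (algebraMap (𝓞 L) L) =
        Matrix.diagonal (fun i : Fin 6 => (sigma ^ (i : ℕ)) a) *
          (codewordO x).map (algebraMap (𝓞 L) L) := by
      ext1 i j
      rw [Matrix.diagonal_mul]
      simp only [codewordO, Matrix.map_apply, Matrix.of_apply, map_mul, coe_sigmaO, hy]
      ring
    have h0 : (codewordO y).det = 0 := by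
      apply RingOfIntegers.ext
      have h := congrArg Matrix.det hmat
      rw [Matrix.det_mul] at h
      have e : ∀ z, ((codewordO z).map (algebraMap (𝓞 L) L)).det = ((codewordO z).det : L) :=
        fun z => (RingHom.map_det (algebraMap (𝓞 L) L) (codewordO z)).symm
      rw [e, e, hdet] at h
      rw [h]
      simp
    rw [h0]
    exact I.zero_mem

end Division

/-! ### Minimum determinants of the code and its subcodes -/

section MinDet

theorem re_det_mul_conjTranspose (A : Matrix (Fin 6) (Fin 6) ℂ) :
    (A * A.conjTranspose).det.re = Complex.normSq A.det := by
  rw [Matrix.det_mul, Matrix.det_conjTranspose, Complex.star_def, Complex.mul_conj,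
    Complex.ofReal_re]

theorem minDet_le {C : Set (Matrix (Fin 6) (Fin 6) ℂ)} {X X' : Matrix (Fin 6) (Fin 6) ℂ}
    (hX : X ∈ C) (hX' : X' ∈ C) (h : X ≠ X') : minDet C ≤ Complex.normSq (X - X').det := by
  apply csInf_le
  · refine ⟨0, ?_⟩
    rintro d ⟨Y, -, Y', -, -, rfl⟩
    rw [re_det_mul_conjTranspose]
    exact Complex.normSq_nonneg _
  · exact ⟨X, hX, X', hX', h, (re_det_mul_conjTranspose _).symm⟩

theorem le_minDet {C : Set (Matrix (Fin 6) (Fin 6) ℂ)} {c : ℝ} (hC : C.Nontrivial)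
    (h : ∀ X ∈ C, ∀ X' ∈ C, X ≠ X' → c ≤ Complex.normSq (X - X').det) : c ≤ minDet C := by
  obtain ⟨X, hX, X', hX', hne⟩ := hC
  refine le_csInf (Set.nonempty_of_mem (x := _) ⟨X, hX, X', hX', hne, rfl⟩) ?_
  rintro d ⟨Y, hY, Y', hY', hne, rfl⟩
  rw [re_det_mul_conjTranspose]
  exact h Y hY Y' hY' hne

/-! ### The norm of an ideal and the least norm of its elements -/

variable {I : Ideal (𝓞 L)}

theorem ne_bot_of_absNorm (hI : Ideal.absNorm I = 7) : I ≠ ⊥ := by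
  rintro rfl
  simp at hI

theorem exists_norm_eq_minNorm (hI : I ≠ ⊥) :
    ∃ x ∈ I, x ≠ 0 ∧ minNorm I = (Algebra.norm ℤ x).natAbs := by
  obtain ⟨x, hx, hx0⟩ := Submodule.exists_mem_ne_zero_of_ne_bot hI
  exact Nat.sInf_mem (s := {m | ∃ x ∈ I, x ≠ 0 ∧ m = (Algebra.norm ℤ x).natAbs}) ⟨_, x, hx, hx0, rfl⟩

theorem minNorm_pos (hI : I ≠ ⊥) : 0 < minNorm I := by
  obtain ⟨x, -, hx0, h⟩ := exists_norm_eq_minNorm hI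
  rw [h]
  exact Int.natAbs_pos.2 (Algebra.norm_ne_zero_iff.2 hx0)

theorem absNorm_le_minNorm (hI : I ≠ ⊥) : Ideal.absNorm I ≤ minNorm I := by
  obtain ⟨x, hx, hx0, h⟩ := exists_norm_eq_minNorm hI
  have hdvd := Ideal.absNorm_dvd_absNorm_of_le ((Ideal.span_singleton_le_iff_mem I).2 hx)
  rw [Ideal.absNorm_span_singleton, ← h] at hdvd
  exact Nat.le_of_dvd (minNorm_pos hI) hdvd

/-- If some `x ∈ I` had norm `N(I)`, the cofactor `J` in `(x) = I J` would have norm 1, so `I =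
(x)`. -/
theorem absNorm_lt_minNorm (hI : I ≠ ⊥) (hp : ¬ Submodule.IsPrincipal I) :
    Ideal.absNorm I < minNorm I := by
  refine lt_of_le_of_ne (absNorm_le_minNorm hI) fun heq => hp ?_
  obtain ⟨x, hx, hx0, h⟩ := exists_norm_eq_minNorm hI
  rw [h, ← Ideal.absNorm_span_singleton] at heq
  obtain ⟨J, hJ⟩ := Ideal.dvd_iff_le.2 ((Ideal.span_singleton_le_iff_mem I).2 hx)
  have hI0 : Ideal.absNorm I ≠ 0 := fun h0 => hI (Ideal.absNorm_eq_zero_iff.1 h0)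
  rw [hJ, map_mul] at heq
  have hJ1 : Ideal.absNorm J = 1 :=
    Nat.eq_of_mul_eq_mul_left (Nat.pos_of_ne_zero hI0) (by rw [← heq, mul_one])
  rw [Ideal.absNorm_eq_one_iff.1 hJ1, Ideal.mul_top] at hJ
  exact ⟨x, hJ.symm⟩

/-! ### Bounds for the minimum determinants -/

variable {K : ℕ} {q : Fin K → Ideal (𝓞 L)} (M : LayerMap I q)

theorem codeword_mem_code (x : Fin 6 → I) : codeword (fun l => (x l : 𝓞 L)) ∈ code M := by
  refine Set.mem_iUnion.2 ⟨fun k l => M.symm (Submodule.Quotient.mk (x l)) k, x, fun l => ?_, rfl⟩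
  exact (M.apply_symm_apply _).symm

theorem mk_eq_zero_iff (z : I) :
    (Submodule.Quotient.mk z : LayerQuotient I q) = 0 ↔ (z : 𝓞 L) ∈ I * ∏ k, q k := by
  rw [Submodule.Quotient.mk_eq_zero]
  rfl

theorem mem_of_symm_eq_zero (hq0 : ∀ k, q k ≠ ⊥) (S : Finset (Fin K)) (z : I)
    (hz : ∀ s ∈ S, M.symm (Submodule.Quotient.mk z) s = 0) :
    (z : 𝓞 L) ∈ I * ∏ s ∈ S, q s := by
  -- Multiplying `z` by an element of `∏_{k∉S} q_k` kills the remaining coordinates, so the product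
  -- is in `I ∏ q_k`; the factor `∏_{k∉S} q_k` then cancels in the Dedekind domain.
  have hle : Ideal.span {(z : 𝓞 L)} * ∏ k ∈ Sᶜ, q k ≤ (I * ∏ s ∈ S, q s) * ∏ k ∈ Sᶜ, q k := by
    rw [mul_assoc, Finset.prod_mul_prod_compl, Ideal.span_singleton_mul_le_iff]
    intro a ha
    have h0 : M.symm (Submodule.Quotient.mk (a • z)) = 0 := by
      rw [Submodule.Quotient.mk_smul, map_smul]
      funext k
      by_cases hk : k ∈ S
      · rw [Pi.smul_apply, hz k hk, smul_zero, Pi.zero_apply]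
      · have hak : a ∈ q k := Ideal.le_of_dvd (Finset.dvd_prod_of_mem q (Finset.mem_compl.2 hk)) ha
        rw [Pi.smul_apply, Pi.zero_apply, Algebra.smul_def, Ideal.Quotient.algebraMap_eq,
          Ideal.Quotient.eq_zero_iff_mem.2 hak, zero_mul]
    rw [LinearEquiv.map_eq_zero_iff, mk_eq_zero_iff] at h0
    rw [mul_comm (z : 𝓞 L)]
    exact h0
  have hne : ∏ k ∈ Sᶜ, q k ≠ 0 := Finset.prod_ne_zero_iff.2 fun k _ => hq0 k
  rw [← Ideal.dvd_iff_le, mul_dvd_mul_iff_right hne, Ideal.dvd_iff_le,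
    Ideal.span_singleton_le_iff_mem] at hle
  exact hle

/-- Required because the infimum of the empty set of reals is 0. Adding a nonzero `z ∈ I ∏ q_k` to
layer 0 changes the codeword but not its message. -/
theorem subcode_nontrivial (h7 : Ideal.span {(7 : 𝓞 L)} = I ^ 6 * conjIdeal I ^ 6)
    (hq0 : ∀ k, q k ≠ ⊥) (S : Finset (Fin K)) (v : Messages q) : (subcode M S v).Nontrivial := by
  have hI := ne_bot_of_absNorm (absNorm_eq_seven h7)
  have hne : I * ∏ k, q k ≠ ⊥ :=
    mul_ne_zero hI (Finset.prod_ne_zero_iff.2 fun k _ => hq0 k)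
  obtain ⟨z, hz, hz0⟩ := Submodule.exists_mem_ne_zero_of_ne_bot hne
  choose x hx using fun l => Submodule.Quotient.mk_surjective _ (M fun k => v k l)
  have hzI : z ∈ I := Ideal.mul_le_left hz
  set z' : Fin 6 → I := Pi.single 0 ⟨z, hzI⟩ with hz'
  have hmem : ∀ y : Fin 6 → I, (∀ l, (Submodule.Quotient.mk (y l) : LayerQuotient I q) =
      M fun k => v k l) → codeword (fun l => (y l : 𝓞 L)) ∈ subcode M S v := fun y hy =>
    Set.mem_biUnion (x := v) (fun _ _ => rfl) ⟨y, hy, rfl⟩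
  refine ⟨_, hmem (x + z') fun l => ?_, _, hmem x hx, fun h => ?_⟩
  · rw [Pi.add_apply, Submodule.Quotient.mk_add, hx]
    suffices (Submodule.Quotient.mk (z' l) : LayerQuotient I q) = 0 by rw [this, add_zero]
    rw [mk_eq_zero_iff, hz']
    rcases eq_or_ne l 0 with rfl | hl
    · rw [Pi.single_eq_same]
      exact hz
    · rw [Pi.single_eq_of_ne hl]
      exact Submodule.zero_mem _
  · have hd := congrArg Matrix.det (sub_eq_zero.2 h)
    have he : (fun l => ((x + z') l : 𝓞 L)) - (fun l => (x l : 𝓞 L)) = Pi.single 0 z := by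
      funext l
      rcases eq_or_ne l 0 with rfl | hl
      · simp [hz']
      · simp [hz', hl]
    rw [codeword_sub, he] at hd
    have hn := normSq_det_single z
    rw [hd, Matrix.det_zero, map_zero] at hn
    have := Int.natAbs_pos.2 (Algebra.norm_ne_zero_iff (R := ℤ).2 hz0)
    exact absurd (by exact_mod_cast hn.symm) this.ne'

theorem absNorm_le_minDet_subcode (h7 : Ideal.span {(7 : 𝓞 L)} = I ^ 6 * conjIdeal I ^ 6)
    (hq0 : ∀ k, q k ≠ ⊥) (S : Finset (Fin K)) (v : Messages q) :
    (Ideal.absNorm (I * ∏ s ∈ S, q s) : ℝ) ≤ minDet (subcode M S v) := by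
  apply le_minDet (subcode_nontrivial M h7 hq0 S v)
  intro X hX X' hX' hne
  obtain ⟨w, hw, x, hx, rfl⟩ := Set.mem_iUnion₂.1 hX
  obtain ⟨w', hw', x', hx', rfl⟩ := Set.mem_iUnion₂.1 hX'
  rw [codeword_sub]
  apply absNorm_le_normSq_det
  · intro l
    apply mem_of_symm_eq_zero M hq0 S (x l - x' l)
    intro s hs
    rw [Submodule.Quotient.mk_sub, hx, hx', map_sub, LinearEquiv.symm_apply_apply,
      LinearEquiv.symm_apply_apply, Pi.sub_apply, hw s hs, hw' s hs, sub_self]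
  · apply det_codewordO_ne_zero h7
    intro h
    exact hne (congrArg codeword (sub_eq_zero.1 h))

theorem subcode_empty (v : Messages q) : subcode M ∅ v = code M := by
  simp [subcode, code]

theorem absNorm_le_minDet_code (h7 : Ideal.span {(7 : 𝓞 L)} = I ^ 6 * conjIdeal I ^ 6)
    (hq0 : ∀ k, q k ≠ ⊥) : (Ideal.absNorm I : ℝ) ≤ minDet (code M) := by
  have h := absNorm_le_minDet_subcode M h7 hq0 ∅ 0
  rwa [Finset.prod_empty, mul_one, subcode_empty] at h

theorem minDet_code_le (h7 : Ideal.span {(7 : 𝓞 L)} = I ^ 6 * conjIdeal I ^ 6) :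
    minDet (code M) ≤ minNorm I := by
  obtain ⟨x, hx, hx0, h⟩ := exists_norm_eq_minNorm (ne_bot_of_absNorm (absNorm_eq_seven h7))
  set y : Fin 6 → I := Pi.single 0 ⟨x, hx⟩ with hy
  have hy' : (fun l => (y l : 𝓞 L)) - (fun l => (((0 : Fin 6 → I) l : I) : 𝓞 L)) =
      Pi.single 0 x := by
    funext l
    rcases eq_or_ne l 0 with rfl | hl
    · simp [hy]
    · simp [hy, hl]
  have hn : Complex.normSq (codeword (fun l => (y l : 𝓞 L)) -
      codeword (fun l => (((0 : Fin 6 → I) l : I) : 𝓞 L))).det = minNorm I := by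
    rw [codeword_sub, hy', normSq_det_single, h]
  rw [← hn]
  refine minDet_le (codeword_mem_code M y) (codeword_mem_code M 0) fun he => ?_
  rw [he, sub_self, Matrix.det_zero, map_zero] at hn
  exact (minNorm_pos (ne_bot_of_absNorm (absNorm_eq_seven h7))).ne' (by exact_mod_cast hn.symm)

/-! ### Rates and decibels -/

variable (q) in
theorem rate_eq (k : Fin K) : rate q k = Real.logb 2 (Ideal.absNorm (q k)) / 12 := by
  have h : Nat.card (Fin 6 → 𝓞 L ⧸ q k) = Ideal.absNorm (q k) ^ 6 := by
    rw [Nat.card_fun, Nat.card_fin, Ideal.absNorm_apply,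
      Submodule.cardQuot_apply]
  rw [rate, h, Nat.cast_pow, Real.logb_pow]
  push_cast
  ring

theorem sum_rate (hq0 : ∀ k, q k ≠ ⊥) (S : Finset (Fin K)) :
    ∑ s ∈ S, rate q s = Real.logb 2 (Ideal.absNorm (∏ s ∈ S, q s)) / 12 := by
  rw [map_prod, Nat.cast_prod, Real.logb_prod, Finset.sum_div]
  · exact Finset.sum_congr rfl fun s _ => rate_eq q s
  · intro s _
    exact Nat.cast_ne_zero.2 fun h => hq0 s (Ideal.absNorm_eq_zero_iff.1 h)

/-- This is `10³ ≤ 2^10`. -/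
theorem logb_ten_two_ge : 6 ≤ 20 * Real.logb 10 2 := by
  have h : Real.logb 10 (10 ^ 3 : ℝ) ≤ Real.logb 10 (2 ^ 10 : ℝ) :=
    Real.logb_le_logb_of_le (by norm_num) (by norm_num) (by norm_num)
  rw [Real.logb_pow, Real.logb_pow, Real.logb_self_eq_one (by norm_num)] at h
  push_cast at h
  linarith

theorem le_gain (h7 : Ideal.span {(7 : 𝓞 L)} = I ^ 6 * conjIdeal I ^ 6) (hq0 : ∀ k, q k ≠ ⊥)
    (S : Finset (Fin K)) (hS : ∃ s ∈ S, q s ≠ ⊤) (v : Messages q) :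
    20 * Real.logb 10 2 + gammaI I ≤ gain M S v := by
  have hI := ne_bot_of_absNorm (absNorm_eq_seven h7)
  set Q : ℕ := Ideal.absNorm (∏ s ∈ S, q s) with hQdef
  set N : ℕ := Ideal.absNorm I with hN
  set m : ℕ := minNorm I with hm
  have hN0 : (0 : ℝ) < N := by rw [hN, absNorm_eq_seven h7]; norm_num
  have hm0 : (0 : ℝ) < m := by exact_mod_cast minNorm_pos hI
  have hNm : (N : ℝ) ≤ m := by exact_mod_cast absNorm_le_minNorm hI
  have hQ0 : Q ≠ 0 := fun h => Finset.prod_ne_zero_iff.2 (fun k _ => hq0 k)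
    (Ideal.absNorm_eq_zero_iff.1 h)
  have hQ1 : Q ≠ 1 := by
    obtain ⟨s, hs, hne⟩ := hS
    intro h
    have hd := map_dvd Ideal.absNorm (Finset.dvd_prod_of_mem q hs)
    rw [← hQdef, h, Nat.dvd_one, Ideal.absNorm_eq_one_iff] at hd
    exact hne hd
  have hQ2 : (2 : ℝ) ≤ Q := by
    have : 2 ≤ Q := by omega
    exact_mod_cast this
  have hc0 : 0 < minDet (code M) := hN0.trans_le (absNorm_le_minDet_code M h7 hq0)
  have hsub : (N : ℝ) * Q ≤ minDet (subcode M S v) := by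
    have h := absNorm_le_minDet_subcode M h7 hq0 S v
    rwa [map_mul, Nat.cast_mul] at h
  have hratio : (N : ℝ) / m * Q ≤ minDet (subcode M S v) / minDet (code M) := by
    rw [div_mul_eq_mul_div]
    exact div_le_div₀ ((mul_nonneg hN0.le (by linarith)).trans hsub) hsub hc0 (minDet_code_le M h7)
  have hr0 : (0 : ℝ) < N / m := div_pos hN0 hm0
  have hlog : Real.logb 10 ((N : ℝ) / m) + Real.logb 10 Q ≤
      Real.logb 10 (minDet (subcode M S v) / minDet (code M)) := by
    rw [← Real.logb_mul hr0.ne' (by linarith)]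
    exact Real.logb_le_logb_of_le (by norm_num) (mul_pos hr0 (by linarith)) hratio
  have hr : Real.logb 10 ((N : ℝ) / m) ≤ 0 :=
    Real.logb_nonpos (by norm_num) hr0.le ((div_le_one hm0).2 hNm)
  have hQlog : 1 ≤ Real.logb 2 Q := by
    rw [Real.le_logb_iff_rpow_le (by norm_num) (by linarith), Real.rpow_one]
    exact hQ2
  have hbase : Real.logb 10 2 * Real.logb 2 Q = Real.logb 10 Q :=
    Real.mul_logb (by norm_num) (by norm_num) (by norm_num)
  rw [gain, sum_rate hq0, ← hQdef, le_div_iff₀ (by linarith), gammaI, ← hN, ← hm]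
  -- The slack is `(log₂ Q - 1)(-log₁₀(N/m)) ≥ 0`: dividing the nonpositive `γ_I` by `log₂ Q ≥ 1`
  -- can only raise it.
  nlinarith [mul_nonneg (sub_nonneg.2 hQlog) (neg_nonneg.2 hr)]

end MinDet

end
end SixBySix

theorem mainTheorem6 (I : Ideal (NumberField.RingOfIntegers SixBySix.L))
    (h7 : Ideal.span {(7 : NumberField.RingOfIntegers SixBySix.L)} =
      I ^ 6 * SixBySix.conjIdeal I ^ 6)
    (K : ℕ) (q : Fin K → Ideal (NumberField.RingOfIntegers SixBySix.L))
    (hq0 : ∀ k, q k ≠ ⊥)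
    (hqq : Pairwise fun j k => IsCoprime (q j) (q k))
    (hqI : ∀ k, IsCoprime (q k) I)
    (M : SixBySix.LayerMap I q) (S : Finset (Fin K)) (hS : ∃ s ∈ S, q s ≠ ⊤)
    (v : SixBySix.Messages q) :
    0 < SixBySix.minDet (SixBySix.code M) ∧
    20 * Real.logb 10 2 + SixBySix.gammaI I ≤ SixBySix.gain M S v ∧
    6 + SixBySix.gammaI I ≤ SixBySix.gain M S v ∧
    (¬ Submodule.IsPrincipal I → SixBySix.gammaI I < 0) := by
  have hN := SixBySix.absNorm_eq_seven h7
  have hI := SixBySix.ne_bot_of_absNorm hN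
  have hgain := SixBySix.le_gain M h7 hq0 S hS v
  refine ⟨?_, hgain, ?_, fun hp => ?_⟩
  · refine lt_of_lt_of_le ?_ (SixBySix.absNorm_le_minDet_code M h7 hq0)
    rw [hN]
    norm_num
  · linarith [SixBySix.logb_ten_two_ge]
  · have hlt : (Ideal.absNorm I : ℝ) < SixBySix.minNorm I := by
      exact_mod_cast SixBySix.absNorm_lt_minNorm hI hp
    have h0 : (0 : ℝ) < Ideal.absNorm I := by
      rw [hN]
      norm_num
    have := Real.logb_neg (b := 10) (by norm_num) (div_pos h0 (h0.trans hlt))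
      ((div_lt_one (h0.trans hlt)).2 hlt)
    rw [SixBySix.gammaI]
    linarith
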